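/- Let $(R,\mathfrak m)$ be a one-dimensional Cohen–Macaulay (Noetherian) local ring whose residue field $R/\mathfrak m$ has characteristic $0$, and let $I$ be an $\mathfrak m$-primary ideal of $R$. An ideal $J\subseteq I$ is called a reduction of $I$ if $JI^n=I^{n+1}$ for some integer $n\ge 0$; the least such $n$ is the reduction number of $I$ with respect to $J$; a minimal reduction of $I$ is a reduction that is minimal with respect to inclusion among all reductions of $I$; and $\operatorname{core}(I)$ is the intersection of all reductions of $I$. Let $x\in R$ be an element such that the principal ideal $(x)$ is a minimal reduction of $I$, and let $r$ be the reduction number of $I$ with respect to $(x)$. Then $$\operatorname{core}(I)=\bigl((x^r):_R I^r\bigr)\,I=\bigl((x^r):_R I^r\bigr)\,x=(x^{r+1}):_R I^r ,$$ where $\mathfrak a:_R\mathfrak b=\{s\in R : s\mathfrak b\subseteq\mathfrak a\}$ for ideals $\mathfrak a,\mathfrak b$ of $R$. -/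

import Mathlib

/-- A Noetherian local ring `R` is Cohen–Macaulay if its depth equals its Krull dimension, i.e. if
its maximal ideal contains an `R`-regular sequence of length `dim R`. -/
def IsCohenMacaulayLocal (R : Type*) [CommRing R] [IsLocalRing R] : Prop :=
  IsNoetherianRing R ∧
    ∃ rs : List R, (∀ a ∈ rs, a ∈ IsLocalRing.maximalIdeal R) ∧
      RingTheory.Sequence.IsRegular R rs ∧ (rs.length : WithBot ℕ∞) = ringKrullDim R

namespace Ideal

variable {R : Type*} [CommRing R]

/-- `J` is a reduction of `I`: `J ⊆ I` and `J I ^ n = I ^ (n + 1)` for some `n`. -/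
def IsReduction (I J : Ideal R) : Prop :=
  J ≤ I ∧ ∃ n : ℕ, J * I ^ n = I ^ (n + 1)

/-- `J` is a minimal reduction of `I`: a reduction of `I` that is minimal with respect to
inclusion among the reductions of `I`. -/
def IsMinimalReduction (I J : Ideal R) : Prop :=
  Minimal (IsReduction I) J

/-- The reduction number of `I` with respect to a reduction `J`: the least `n` such that
`J I ^ n = I ^ (n + 1)`. -/
noncomputable def reductionNumber (I J : Ideal R) : ℕ :=
  sInf {n : ℕ | J * I ^ n = I ^ (n + 1)}

/-- The core of `I`: the intersection of all reductions of `I`. -/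
def core (I : Ideal R) : Ideal R :=
  sInf {J : Ideal R | IsReduction I J}

end Ideal

/-! Let C be the colon ideal `(x^r) : I^r`. Since `x` is regular, work in `R[1/x]`. A reduction J
contains Cx because `x^(n+r+1)` lies in `J I^(n+r) = x^n J I^r`, and C sends `I^r` into `(x^r)`.
Conversely, let `sx` lie in the core, `y ∈ I`, `u = y/x`. As `u` preserves `I^r`, it is integral. If
`u - n` is invertible in `R[u]`, then `y - nx` generates a reduction, so `s/(u - n) ∈ R`. Partial
fractions over enough integers `n` give `s u^r ∈ R`, that is `s y^r ∈ (x^r)`. In residue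
characteristic 0 the powers `y^r` generate `I^r`, so `s ∈ C`. -/

open Polynomial in
/-- If a submodule contains the inverses of `u - n` for almost all `n`, it contains the powers of
`u`. -/
theorem Submodule.pow_mem_of_forall_inv_sub_natCast_mem {R K : Type*} [CommRing R] [IsLocalRing R]
    [CharZero (IsLocalRing.ResidueField R)] [CommRing K] [Algebra R K] (N : Submodule R K) {u : K}
    (hu : IsIntegral R u)
    (hN : ∀ n : ℕ, ∀ v ∈ Algebra.adjoin R {u}, (u - n) * v = 1 → v ∈ N) (j : ℕ) : u ^ j ∈ N := by
  classical
  have hunit : ∀ n m : ℕ, n ≠ m → IsUnit ((n : R) - m) := by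
    intro n m h
    rw [← IsLocalRing.residue_ne_zero_iff_isUnit]
    simpa [sub_eq_zero] using h
  obtain ⟨f, hf, hfu⟩ := hu
  have hgood : {n : ℕ | IsUnit (f.eval (n : R))}.Infinite := by
    set g := f.map (IsLocalRing.residue R)
    have hg : g ≠ 0 := (hf.map _).ne_zero
    have hfin : {n : ℕ | (n : IsLocalRing.ResidueField R) ∈ g.roots.toFinset}.Finite :=
      Set.Finite.preimage Nat.cast_injective.injOn (Finset.finite_toSet _)
    refine hfin.infinite_compl.mono fun n hn => ?_
    simp only [Set.mem_compl_iff, Set.mem_ofPred_eq, Multiset.mem_toFinset, mem_roots hg, IsRoot.def]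
      at hn
    rw [Set.mem_ofPred_eq, ← IsLocalRing.residue_ne_zero_iff_isUnit]
    rwa [← map_natCast (IsLocalRing.residue R), eval_map_apply] at hn
  have hinv : ∀ n : ℕ, IsUnit (f.eval (n : R)) →
      ∃ v ∈ Algebra.adjoin R {u}, (u - n) * v = 1 := by
    rintro n ⟨e, he⟩
    -- As `f(u) = 0`, the factor theorem gives `(u - n) q(u) = -f(n)`.
    obtain ⟨q, hq⟩ := X_sub_C_dvd_sub_C_eval (a := (n : R)) (p := f)
    have h := congrArg (aeval u) hq
    have hfu' : aeval u f = 0 := hfu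
    simp only [map_sub, map_mul, aeval_X, aeval_C, hfu', map_natCast, zero_sub] at h
    refine ⟨aeval u q * algebraMap R K (-(↑e⁻¹ : R)), mul_mem (aeval_mem_adjoin_singleton R u)
      (Subalgebra.algebraMap_mem _ _), ?_⟩
    rw [← mul_assoc, ← h, ← he, map_neg, neg_mul_neg, ← map_mul, Units.mul_inv, map_one]
  choose! v hvmem hv using hinv
  obtain ⟨T, hTgood, hTcard⟩ := hgood.exists_subset_card_eq f.natDegree
  -- Partial fractions: `(u - m) - (u - n) = n - m` is a unit, which handles `i < c`; the top power
  -- uses `u = (u - n) + n`.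
  have key : ∀ c : ℕ, ∀ T : Finset ℕ, (∀ n ∈ T, IsUnit (f.eval (n : R))) → T.card = c →
      ∀ i < c, u ^ i * ∏ n ∈ T, v n ∈ N := by
    intro c
    induction c with
    | zero => intro T _ _ i hi; omega
    | succ c ih =>
      intro T hT hc i hi
      rcases Nat.eq_zero_or_pos c with rfl | hpos
      · obtain ⟨n, rfl⟩ := Finset.card_eq_one.mp hc
        obtain rfl : i = 0 := by omega
        have hn := hT n (by simp)
        simpa using hN n (v n) (hvmem n hn) (hv n hn)
      · obtain ⟨n, hn, m, hm, hnm⟩ := Finset.one_lt_card.mp (by omega : 1 < T.card)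
        have herase : ∀ k ∈ T, ∀ i < c, u ^ i * ((u - k) * ∏ n ∈ T, v n) ∈ N := by
          intro k hk i hi
          have := ih (T.erase k) (fun n hn => hT n (Finset.mem_of_mem_erase hn))
            (by rw [Finset.card_erase_of_mem hk]; omega) i hi
          rwa [← Finset.mul_prod_erase T v hk, ← mul_assoc (u - k), hv k (hT k hk), one_mul]
        have hlow : ∀ i < c, u ^ i * ∏ n ∈ T, v n ∈ N := by
          intro i hi
          have h := N.sub_mem (herase m hm i hi) (herase n hn i hi)
          rw [← N.smul_mem_iff_of_isUnit (hunit n m hnm)]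
          convert h using 1
          rw [Algebra.smul_def, map_sub, map_natCast, map_natCast]
          ring
        rcases Nat.lt_or_ge i c with h | h
        · exact hlow i h
        · obtain ⟨i, rfl⟩ : ∃ k, i = k + 1 := ⟨i - 1, by omega⟩
          have h := N.add_mem (herase n hn i (by omega))
            (N.smul_mem (n : R) (hlow i (by omega)))
          convert h using 1
          rw [Algebra.smul_def, map_natCast]
          ring
  have hpoly : ∀ q : R[X], aeval u q * ∏ n ∈ T, v n ∈ N := by
    intro q
    nontriviality R
    have h1 : aeval u q = aeval u (q %ₘ f) := by
      conv_lhs => rw [← modByMonic_add_div q f]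
      have hfu' : aeval u f = 0 := hfu
      simp [hfu']
    rw [h1, aeval_def, eval₂_eq_sum, Polynomial.sum, Finset.sum_mul]
    refine N.sum_mem fun i hi => ?_
    rw [mul_assoc, ← Algebra.smul_def]
    refine N.smul_mem _ (key _ T hTgood hTcard i ?_)
    have := (le_degree_of_mem_supp i hi).trans_lt (degree_modByMonic_lt q hf)
    rwa [degree_eq_natDegree hf.ne_zero, Nat.cast_lt] at this
  have h := hpoly (X ^ j * ∏ n ∈ T, (X - C (n : R)))
  have h1 : (∏ n ∈ T, (u - (n : K))) * ∏ n ∈ T, v n = 1 := by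
    rw [← Finset.prod_mul_distrib]
    exact Finset.prod_eq_one fun n hn => hv n (hTgood hn)
  simpa [map_prod, mul_assoc, h1] using h

/-- The coefficients of a polynomial function with values in a submodule on the natural numbers
belong to that submodule. -/
theorem Submodule.mem_of_forall_sum_natCast_pow_smul_mem {R M : Type*} [CommRing R]
    [AddCommGroup M] [Module R M] (hR : ∀ n : ℕ, n ≠ 0 → IsUnit (n : R)) (N : Submodule R M) {n : ℕ}
    (c : Fin (n + 1) → M) (h : ∀ k : ℕ, ∑ i : Fin (n + 1), (k : R) ^ (i : ℕ) • c i ∈ N) (i : Fin (n + 1)) :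
    c i ∈ N := by
  set V := Matrix.vandermonde fun i : Fin (n + 1) => (i : R)
  have hV : IsUnit V.det := by
    rw [Matrix.det_vandermonde_id_eq_superFactorial]
    have hpos : ∀ m : ℕ, Nat.superFactorial m ≠ 0 := by
      intro m
      induction m with
      | zero => simp
      | succ m ih => exact mul_ne_zero (Nat.factorial_ne_zero _) ih
    exact hR _ (hpos n)
  have hc : ∑ k, V⁻¹ i k • ∑ j, V k j • c j = c i := by
    simp_rw [Finset.smul_sum, smul_smul]
    rw [Finset.sum_comm]
    simp_rw [← Finset.sum_smul, ← Matrix.mul_apply, Matrix.nonsing_inv_mul V hV, Matrix.one_apply,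
      ite_smul, one_smul, zero_smul]
    simp
  rw [← hc]
  exact N.sum_mem fun k _ => N.smul_mem _ (h k)

namespace Ideal

/-- Powers of ideals are generated by powers of elements if the positive integers are units. -/
theorem pow_le_of_forall_pow_mem {R : Type*} [CommRing R]
    (hR : ∀ n : ℕ, n ≠ 0 → IsUnit (n : R)) (I : Ideal R) (n : ℕ) :
    ∀ N : Ideal R, (∀ y ∈ I, y ^ n ∈ N) → I ^ n ≤ N := by
  induction n with
  | zero =>
    intro N h
    have := h 0 I.zero_mem
    simpa [Ideal.eq_top_iff_one] using this
  | succ n ih =>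
    intro N h
    rw [pow_succ, Ideal.mul_le]
    intro a ha v hv
    suffices I ^ n ≤ N.colon {v} by
      simpa using Submodule.mem_colon_singleton.mp (this ha)
    refine ih _ fun y hy => Submodule.mem_colon_singleton.mpr ?_
    -- Polarization: the coefficient of `k` in `(kv + y)^(n+1)` is `(n+1) v y^n`.
    have hmem := Submodule.mem_of_forall_sum_natCast_pow_smul_mem hR N
      (fun i : Fin (n + 1 + 1) => v ^ (i : ℕ) * y ^ (n + 1 - i) * ((n + 1).choose i : R))
      (fun k => by
        have := h (k * v + y) (I.add_mem (I.mul_mem_left _ hv) hy)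
        rw [add_pow, ← Fin.sum_univ_eq_sum_range (fun m => ((k : R) * v) ^ m * y ^ (n + 1 - m) *
          ((n + 1).choose m : R))] at this
        convert this using 2 with i
        rw [smul_eq_mul]
        ring) 1
    have hn := hR (n + 1) n.succ_ne_zero
    rw [smul_eq_mul, ← mul_unit_mem_iff_mem N hn, mul_comm (y ^ n)]
    simpa using hmem

/-! ### The two inclusions for the core and the equality of the three formulas. -/

variable {R : Type*} [CommRing R]

theorem mul_pow_reductionNumber {I J : Ideal R} (h : I.IsReduction J) :
    J * I ^ I.reductionNumber J = I ^ (I.reductionNumber J + 1) :=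
  Nat.sInf_mem h.2

theorem colon_mul_span_le_of_isReduction {I J : Ideal R} {x : R} (hx : IsSMulRegular R x) {r : ℕ}
    (hxI : x ∈ I) (hr : span {x} * I ^ r = I ^ (r + 1)) (hJ : I.IsReduction J) :
    (span {x ^ r}).colon ((I ^ r : Ideal R) : Set R) * span {x} ≤ J := by
  obtain ⟨-, n, hn⟩ := hJ
  have hpow : ∀ k, I ^ (r + k) = span {x ^ k} * I ^ r := by
    intro k
    induction k with
    | zero => simp
    | succ k ih =>
      rw [← add_assoc, pow_succ, ih, mul_assoc, ← pow_succ, ← hr, ← mul_assoc,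
        span_singleton_mul_span_singleton, ← pow_succ]
  rw [mul_le]
  intro s hs z hz
  obtain ⟨b, rfl⟩ := mem_span_singleton'.mp hz
  have hle : ∀ w ∈ J * I ^ (n + r), ∃ e ∈ J, s * w = x ^ (n + r) * e := by
    intro w hw
    refine Submodule.mul_induction_on hw (fun a ha c hc => ?_) ?_
    · rw [add_comm, hpow] at hc
      obtain ⟨c', hc', rfl⟩ := mem_span_singleton_mul.mp hc
      obtain ⟨d, hd⟩ := mem_span_singleton'.mp (Submodule.mem_colon.mp hs c' hc')
      rw [smul_eq_mul] at hd
      refine ⟨d * a, J.mul_mem_left _ ha, ?_⟩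
      linear_combination (-a * x ^ n) * hd
    · rintro a c ⟨e, he, hae⟩ ⟨e', he', hce⟩
      exact ⟨e + e', J.add_mem he he', by rw [mul_add, mul_add, hae, hce]⟩
  obtain ⟨e, he, hxe⟩ := hle (x ^ (n + r + 1)) (by
    rw [pow_add I, ← mul_assoc, hn, ← pow_add]
    rw [add_right_comm n 1 r]
    exact pow_mem_pow hxI (n + r + 1))
  have : s * x = e := (hx.pow (n + r)) (by simp only [smul_eq_mul]; linear_combination hxe)
  rw [mul_left_comm, this]
  exact J.mul_mem_left _ he

theorem core_le_colon_mul_span [IsLocalRing R] [IsNoetherianRing R]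
    [CharZero (IsLocalRing.ResidueField R)] {I : Ideal R} {x : R} (hx : IsSMulRegular R x) {r : ℕ}
    (hxI : x ∈ I) (hr : span {x} * I ^ r = I ^ (r + 1)) :
    I.core ≤ (span {x ^ r}).colon ((I ^ r : Ideal R) : Set R) * span {x} := by
  have hR : ∀ n : ℕ, n ≠ 0 → IsUnit (n : R) := by
    intro n h
    rw [← IsLocalRing.residue_ne_zero_iff_isUnit]
    simpa using h
  intro a ha
  have hcore : ∀ z ∈ I, span {z} * I ^ r = I ^ (r + 1) → a ∈ span {z} := fun z hz h =>
    (mem_sInf.mp ha) ⟨(span_singleton_le_iff_mem _).mpr hz, r, h⟩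
  obtain ⟨s, rfl⟩ := mem_span_singleton'.mp (hcore x hxI hr)
  refine mul_mem_mul ?_ (mem_span_singleton_self x)
  let K := Localization.Away x
  have hinj : Function.Injective (algebraMap R K) :=
    IsLocalization.injective K (M := Submonoid.powers x) (by
      rw [Submonoid.powers_le, mem_nonZeroDivisors_iff_right]
      intro z hz
      exact hx (by simpa [mul_comm] using hz))
  obtain ⟨w, hw⟩ : ∃ w : K, algebraMap R K x * w = 1 :=
    (IsLocalization.Away.algebraMap_isUnit (S := K) x).exists_right_inv
  suffices ∀ y ∈ I, y ^ r ∈ (span {x ^ r}).colon {s} by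
    have := pow_le_of_forall_pow_mem hR I r _ this
    refine Submodule.mem_colon.mpr fun z hz => ?_
    simpa [mul_comm] using Submodule.mem_colon_singleton.mp (this hz)
  intro y hy
  set u : K := algebraMap R K y * w with hu
  have hux : algebraMap R K x * u = algebraMap R K y := by
    rw [hu, mul_left_comm, hw, mul_one]
  -- `I^r` is stable under `R[u]`, since `y I^r ⊆ I^(r+1) = x I^r`.
  have hstab : ∀ v ∈ Algebra.adjoin R {u}, ∀ b ∈ I ^ r, ∃ b' ∈ I ^ r,
      v * algebraMap R K b = algebraMap R K b' := by
    intro v hv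
    induction hv using Algebra.adjoin_induction with
    | mem v hv =>
      obtain rfl := Set.mem_singleton_iff.mp hv
      intro b hb
      have : y * b ∈ span {x} * I ^ r := by
        rw [hr, pow_succ']
        exact mul_mem_mul hy hb
      obtain ⟨b', hb', h⟩ := mem_span_singleton_mul.mp this
      refine ⟨b', hb', ?_⟩
      have h' := congrArg (algebraMap R K) h
      rw [map_mul, map_mul] at h'
      rw [hu]
      linear_combination (-w) * h' + algebraMap R K b' * hw
    | algebraMap c =>
      exact fun b hb => ⟨c * b, mul_mem_left _ _ hb, (map_mul _ _ _).symm⟩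
    | add v v' _ _ h h' =>
      intro b hb
      obtain ⟨d, hd, e⟩ := h b hb
      obtain ⟨d', hd', e'⟩ := h' b hb
      exact ⟨d + d', add_mem hd hd', by rw [add_mul, e, e', map_add]⟩
    | mul v v' _ _ h h' =>
      intro b hb
      obtain ⟨d', hd', e'⟩ := h' b hb
      obtain ⟨d, hd, e⟩ := h d' hd'
      exact ⟨d, hd, by rw [mul_assoc, e', e]⟩
  have hint : IsIntegral R u := by
    refine IsIntegral.of_mem_of_fg (Algebra.adjoin R {u}) ?_ u (Algebra.self_mem_adjoin_singleton R u)
    -- `R[u]` lies in the finite module `x^(-r) I^r`, because `x^r ∈ I^r`.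
    let L : Submodule R K := Submodule.map ((LinearMap.mulRight R (w ^ r)) ∘ₗ Algebra.linearMap R K) (I ^ r)
    have hL : L.FG := (IsNoetherian.noetherian (I ^ r)).map _
    have : IsNoetherian R L := isNoetherian_of_fg_of_noetherian L hL
    refine Submodule.FG.of_le_of_isNoetherian (T := L) fun v hv => ?_
    obtain ⟨b, hb, h⟩ := hstab v hv (x ^ r) (pow_mem_pow hxI r)
    refine ⟨b, hb, ?_⟩
    simp only [LinearMap.comp_apply, Algebra.linearMap_apply, LinearMap.mulRight_apply]
    rw [← h, map_pow, mul_assoc, ← mul_pow, hw, one_pow, mul_one]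
  -- N consists of the `v` with `s v ∈ R`.
  let N : Submodule R K := (1 : Submodule R K).comap (LinearMap.mulLeft R (algebraMap R K s))
  have hN : u ^ r ∈ N := by
    refine N.pow_mem_of_forall_inv_sub_natCast_mem hint (fun n v hv huv => ?_) r
    have hfac : algebraMap R K (y - n * x) = algebraMap R K x * (u - n) := by
      rw [mul_sub, hux, map_sub, map_mul, map_natCast]
      ring
    have hz : y - n * x ∈ I := sub_mem hy (mul_mem_left _ _ hxI)
    -- With `v` inverse to `u - n`, `x b = (y - nx)(v b)` and `v b ∈ I^r`.
    have hmem := hcore (y - n * x) hz (le_antisymm (by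
        rw [pow_succ']
        exact mul_mono_left ((span_singleton_le_iff_mem _).mpr hz)) (by
        rw [← hr]
        intro d hd
        obtain ⟨b, hb, rfl⟩ := mem_span_singleton_mul.mp hd
        obtain ⟨b', hb', h⟩ := hstab v hv b hb
        refine mem_span_singleton_mul.mpr ⟨b', hb', hinj ?_⟩
        rw [map_mul, hfac, ← h, map_mul]
        linear_combination (algebraMap R K x * algebraMap R K b) * huv))
    obtain ⟨c, hc⟩ := mem_span_singleton'.mp hmem
    refine Submodule.mem_one.mpr ⟨c, ?_⟩
    have h' := congrArg (algebraMap R K) hc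
    rw [map_mul, map_mul, hfac] at h'
    rw [LinearMap.mulLeft_apply]
    linear_combination (w * v) * h' - (algebraMap R K c - algebraMap R K s * v) * hw
      - algebraMap R K c * algebraMap R K x * w * huv
  obtain ⟨c, hc⟩ := Submodule.mem_one.mp hN
  rw [LinearMap.mulLeft_apply] at hc
  refine Submodule.mem_colon_singleton.mpr (mem_span_singleton'.mpr ⟨c, hinj ?_⟩)
  rw [smul_eq_mul, map_mul, map_mul, hc, map_pow, map_pow, ← hux, mul_pow]
  ring

/-- Since `s y I^r ⊆ s x I^r ⊆ (x^(r+1))`, testing on `x^r` gives `s y = t x`, and cancelling `x`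
puts `t` in the colon. -/
theorem colon_mul_span_eq_colon_mul {I : Ideal R} {x : R} (hx : IsSMulRegular R x) {r : ℕ}
    (hxI : x ∈ I) (hr : span {x} * I ^ r = I ^ (r + 1)) :
    (span {x ^ r}).colon ((I ^ r : Ideal R) : Set R) * span {x} =
      (span {x ^ r}).colon ((I ^ r : Ideal R) : Set R) * I := by
  refine le_antisymm (mul_mono_right ((span_singleton_le_iff_mem _).mpr hxI)) ?_
  rw [mul_le]
  intro s hs y hy
  have hdiv : ∀ b ∈ I ^ r, ∃ c, s * y * b = x ^ (r + 1) * c := by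
    intro b hb
    have : y * b ∈ span {x} * I ^ r := by
      rw [hr, pow_succ']
      exact mul_mem_mul hy hb
    obtain ⟨b', hb', h⟩ := mem_span_singleton_mul.mp this
    obtain ⟨c, hc⟩ := mem_span_singleton'.mp (Submodule.mem_colon.mp hs b' hb')
    rw [smul_eq_mul] at hc
    exact ⟨c, by linear_combination (-s) * h - x * hc⟩
  obtain ⟨t, ht⟩ := hdiv _ (pow_mem_pow hxI r)
  have hst : s * y = t * x := (hx.pow r) (by simp only [smul_eq_mul]; linear_combination ht)
  rw [hst]
  refine mul_mem_mul (Submodule.mem_colon.mpr fun b hb => ?_) (mem_span_singleton_self x)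
  obtain ⟨c, hc⟩ := hdiv b hb
  refine mem_span_singleton'.mpr ⟨c, hx ?_⟩
  simp only [smul_eq_mul]
  linear_combination b * hst - hc

theorem colon_mul_span_eq_colon {I : Ideal R} {x : R} (hx : IsSMulRegular R x) (r : ℕ)
    (hxI : x ∈ I) :
    (span {x ^ r}).colon ((I ^ r : Ideal R) : Set R) * span {x} =
      (span {x ^ (r + 1)}).colon ((I ^ r : Ideal R) : Set R) := by
  refine le_antisymm ?_ fun s hs => ?_
  · rw [mul_le]
    intro s hs z hz
    obtain ⟨d, rfl⟩ := mem_span_singleton'.mp hz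
    refine Submodule.mem_colon.mpr fun b hb => ?_
    obtain ⟨c, hc⟩ := mem_span_singleton'.mp (Submodule.mem_colon.mp hs b hb)
    rw [smul_eq_mul] at hc
    refine mem_span_singleton'.mpr ⟨c * d, ?_⟩
    rw [smul_eq_mul]
    linear_combination (x * d) * hc
  · have hdiv : ∀ b ∈ I ^ r, ∃ c, c * x ^ (r + 1) = s * b := fun b hb =>
      mem_span_singleton'.mp (Submodule.mem_colon.mp hs b hb)
    obtain ⟨t, ht⟩ := hdiv _ (pow_mem_pow hxI r)
    have hst : s = t * x := (hx.pow r) (by simp only [smul_eq_mul]; linear_combination -ht)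
    rw [hst]
    refine mul_mem_mul (Submodule.mem_colon.mpr fun b hb => ?_) (mem_span_singleton_self x)
    obtain ⟨c, hc⟩ := hdiv b hb
    refine mem_span_singleton'.mpr ⟨c, hx ?_⟩
    simp only [smul_eq_mul]
    linear_combination hc + b * hst

end Ideal

/-! ### Regularity of `x` and the conclusion. -/

theorem IsCohenMacaulayLocal.exists_isSMulRegular {R : Type*} [CommRing R] [IsLocalRing R]
    (hCM : IsCohenMacaulayLocal R) (hdim : ringKrullDim R = 1) :
    ∃ a ∈ IsLocalRing.maximalIdeal R, IsSMulRegular R a := by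
  obtain ⟨-, rs, hmem, hreg, hlen⟩ := hCM
  rw [hdim] at hlen
  cases rs with
  | nil => simp at hlen
  | cons a rs =>
    exact ⟨a, hmem a (by simp), ((RingTheory.Sequence.isRegular_cons_iff R a rs).mp hreg).1⟩

/-- Some power of a regular element of the maximal ideal is a multiple of `x`, and divisors of
regular elements are regular. -/
theorem Ideal.IsReduction.isSMulRegular_of_radical_eq {R : Type*} [CommRing R] [IsLocalRing R]
    (hCM : IsCohenMacaulayLocal R) (hdim : ringKrullDim R = 1) {I : Ideal R}
    (hIm : I.radical = IsLocalRing.maximalIdeal R) {x : R} (hx : I.IsReduction (Ideal.span {x})) :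
    IsSMulRegular R x := by
  obtain ⟨a, ha, hreg⟩ := hCM.exists_isSMulRegular hdim
  rw [← hIm] at ha
  obtain ⟨k, hk⟩ := ha
  obtain ⟨-, n, hn⟩ := hx
  have hmem : (a ^ k) ^ (n + 1) ∈ Ideal.span {x} := by
    refine Ideal.mul_le_left (J := I ^ n) ?_
    rw [hn]
    exact Ideal.pow_mem_pow hk (n + 1)
  obtain ⟨c, hc⟩ := Ideal.mem_span_singleton'.mp hmem
  have h := (hreg.pow k).pow (n + 1)
  rw [← hc] at h
  exact IsSMulRegular.of_mul h

theorem corollary3p4 {R : Type*} [CommRing R] [IsLocalRing R]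
    (hCM : IsCohenMacaulayLocal R) (hdim : ringKrullDim R = 1)
    (hchar : CharZero (IsLocalRing.ResidueField R))
    (I : Ideal R) (hI : I.IsPrimary) (hIm : I.radical = IsLocalRing.maximalIdeal R)
    (x : R) (hx : I.IsMinimalReduction (Ideal.span {x}))
    (r : ℕ) (hr : r = I.reductionNumber (Ideal.span {x})) :
    I.core = (Ideal.span {x ^ r}).colon ((I ^ r : Ideal R) : Set R) * I ∧
    I.core = (Ideal.span {x ^ r}).colon ((I ^ r : Ideal R) : Set R) * Ideal.span {x} ∧
    I.core = (Ideal.span {x ^ (r + 1)}).colon ((I ^ r : Ideal R) : Set R) := by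
  have := hCM.1
  have hred : I.IsReduction (Ideal.span {x}) := hx.prop
  have hreg := hred.isSMulRegular_of_radical_eq hCM hdim hIm
  have hxI : x ∈ I := (Ideal.span_singleton_le_iff_mem _).mp hred.1
  have hpow := Ideal.mul_pow_reductionNumber hred
  rw [← hr] at hpow
  have hcore : I.core =
      (Ideal.span {x ^ r}).colon ((I ^ r : Ideal R) : Set R) * Ideal.span {x} :=
    le_antisymm (Ideal.core_le_colon_mul_span hreg hxI hpow)
      (le_sInf fun J hJ => Ideal.colon_mul_span_le_of_isReduction hreg hxI hpow hJ)
  exact ⟨hcore.trans (Ideal.colon_mul_span_eq_colon_mul hreg hxI hpow), hcore,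
    hcore.trans (Ideal.colon_mul_span_eq_colon hreg r hxI)⟩
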